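/- Proposition (polynomial Kahane inequality). Let $1\le s\le r<\infty$, let $X$ be a complex Banach space, let $N,m\in\mathbb N_0$, and let $(x_\alpha)$ be a family of vectors in $X$ indexed by the multi-indices $\alpha=(\alpha_1,\dots,\alpha_N)\in\mathbb N_0^N$ with $|\alpha|:=\alpha_1+\cdots+\alpha_N=m$. Let $\mathbb T=\{z\in\mathbb C:|z|=1\}$, let $\mathbb T^N$ carry the $N$-fold product $dz$ of the normalized Lebesgue measure on $\mathbb T$, and write $z^\alpha=z_1^{\alpha_1}\cdots z_N^{\alpha_N}$. Then \[ \bigg(\int_{\mathbb T^N}\Big\|\sum_{|\alpha|=m}x_\alpha z^\alpha\Big\|^r\,dz\bigg)^{1/r}\le\Big(\frac rs\Big)^{m/2}\bigg(\int_{\mathbb T^N}\Big\|\sum_{|\alpha|=m}x_\alpha z^\alpha\Big\|^s\,dz\bigg)^{1/s}. \] -/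

import Mathlib

/-- The unit circle `𝕋 = {z : ℂ | ‖z‖ = 1}` with its Borel σ-algebra. -/
noncomputable instance circleMeasurableSpace : MeasurableSpace Circle := borel Circle

instance circleBorelSpace : BorelSpace Circle := ⟨rfl⟩

/-- The normalized Lebesgue measure on the unit circle: the image of `dt / (2π)` on `(-π, π]`
under `t ↦ exp (i t)`. -/
noncomputable def circleMeasure : MeasureTheory.Measure Circle :=
  (ENNReal.ofReal (2 * Real.pi)⁻¹ •
    MeasureTheory.volume.restrict (Set.Ioc (-Real.pi) Real.pi)).map Circle.exp

/-- The product of `N` copies of the normalized Lebesgue measure, on `𝕋^N`. -/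
noncomputable def torusMeasure (N : ℕ) : MeasureTheory.Measure (Fin N → Circle) :=
  MeasureTheory.Measure.pi fun _ => circleMeasure

/-- The `m`-homogeneous polynomial `∑_{|α| = m} x_α z^α` in `N` variables, with vector coefficients,
on the torus. The finset `Finset.univ.piAntidiag m` consists of the multi-indices
`α : Fin N → ℕ` with `∑ i, α i = m`. -/
noncomputable def homogPoly {X : Type*} [AddCommGroup X] [Module ℂ X] {N : ℕ} (m : ℕ)
    (x : (Fin N → ℕ) → X) (z : Fin N → Circle) : X :=
  ∑ α ∈ (Finset.univ : Finset (Fin N)).piAntidiag m, (∏ i, (z i : ℂ) ^ α i) • x α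

/-!
The factor `(r / s) ^ (m / 2)` is what homogeneity makes of a contractive estimate: with
`ρ = √(s / r)`, the dilation `z ↦ ρ z` maps the `L^s` norm of an analytic polynomial into its `L^r`
norm without loss, and on `m`-homogeneous polynomials it is multiplication by `ρ ^ m`
(`integral_torus_norm_rpow_dilation_le`). The several-variable estimate follows by induction from
the one-variable estimate for functions with values in a normed space
(`circleAverage_norm_rpow_le`), applied to functions with values in `L^r` of the other variables.

In one variable, `log ‖f‖` is subharmonic, so it may be replaced by a harmonic function `u`, and one
has to show that `(avg exp (r u(ρ ·))) ^ (1 / r) ≤ (avg exp (s u)) ^ (1 / s)` on the unit circle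
(`circleAverage_exp_mul_re_le`). By the Gibbs variational principle (`gibbs_circleAverage`) and the
self-adjointness of harmonic extension (`circleAverage_re_mul_re_dilation`), this is dual to the
statement that the entropy of a positive function `f` on the circle decreases at least by the factor
`ρ²` under harmonic extension to the circle of radius `ρ` (`entropy_circleAverage_le`).

For the entropy, let `f = Re F` be harmonic and positive. The Laplacian of `f log f` is
`‖F'‖² / f`, which is again subharmonic because `(a, b) ↦ ‖a‖² / b` is jointly convex; hence its
circular means increase with the radius (`circleAverage_norm_deriv_sq_div_mono`). Integrating this
monotonicity twice in the radius shows that the entropy on the circle of radius `r`, divided by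
`r²`, is nondecreasing in `r`.
-/

open Complex MeasureTheory Metric Real Set Filter Topology

/-! ### Approximation on the circle, positivity and tangent planes -/

/-- The real part of a trigonometric polynomial agrees on the circle with the real part of an
algebraic polynomial: a frequency `-n` is reflected to `n` by conjugating its coefficient. The
factor `c` is there to make the statement stable under complex scalars. -/
theorem exists_polynomial_re_eq_of_mem_span_fourier [Fact (0 < 2 * π)]
    {g : C(AddCircle (2 * π), ℂ)} (hg : g ∈ Submodule.span ℂ (range (@fourier (2 * π)))) (c : ℂ) :
    ∃ P : Polynomial ℂ, ∀ x : ℝ, (c * g x).re = (P.eval (Complex.exp (x * I))).re := by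
  have hf (n : ℕ) (x : ℝ) : fourier n (x : AddCircle (2 * π)) = Complex.exp (x * I) ^ n := by
    rw [fourier_coe_apply, ← Complex.exp_nat_mul]
    congr 1
    have : (π : ℂ) ≠ 0 := by exact_mod_cast Real.pi_ne_zero
    push_cast
    field_simp
  induction hg using Submodule.span_induction generalizing c with
  | mem g h =>
    obtain ⟨n, rfl⟩ := h
    obtain ⟨n, rfl | rfl⟩ := n.eq_nat_or_neg
    · refine ⟨Polynomial.C c * Polynomial.X ^ n, fun x ↦ ?_⟩
      simp [hf]
    · refine ⟨Polynomial.C (starRingEnd ℂ c) * Polynomial.X ^ n, fun x ↦ ?_⟩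
      rw [fourier_neg, hf, ← Complex.conj_re]
      simp
  | zero => exact ⟨0, by simp⟩
  | add g h _ _ hg hh =>
    obtain ⟨P, hP⟩ := hg c
    obtain ⟨Q, hQ⟩ := hh c
    refine ⟨P + Q, fun x ↦ ?_⟩
    rw [ContinuousMap.add_apply, mul_add, add_re, hP, hQ, Polynomial.eval_add, add_re]
  | smul a g _ hg =>
    obtain ⟨P, hP⟩ := hg (c * a)
    refine ⟨P, fun x ↦ ?_⟩
    rw [← hP, ContinuousMap.smul_apply, smul_eq_mul, mul_assoc]

/-- Real continuous functions on the unit circle are uniformly approximated by real parts of entire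
functions, by the density of trigonometric polynomials. -/
theorem exists_differentiable_abs_re_sub_lt {g : ℂ → ℝ} (hg : ContinuousOn g (sphere 0 1))
    {ε : ℝ} (hε : 0 < ε) :
    ∃ F : ℂ → ℂ, Differentiable ℂ F ∧ ∀ z ∈ sphere (0 : ℂ) 1, |(F z).re - g z| < ε := by
  have : Fact (0 < 2 * π) := ⟨Real.two_pi_pos⟩
  let G : C(AddCircle (2 * π), ℂ) :=
    ⟨fun x ↦ (g (AddCircle.toCircle x) : ℂ), by
      refine Complex.continuous_ofReal.comp (hg.comp_continuous ?_ ?_)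
      · exact continuous_subtype_val.comp AddCircle.continuous_toCircle
      · exact fun x ↦ mem_sphere_zero_iff_norm.2 (Circle.norm_coe _)⟩
  have hG : G ∈ (Submodule.span ℂ (range (@fourier (2 * π)))).topologicalClosure := by
    rw [span_fourier_closure_eq_top]; trivial
  obtain ⟨T, hT, hGT⟩ := Metric.mem_closure_iff.1 hG ε hε
  obtain ⟨P, hP⟩ := exists_polynomial_re_eq_of_mem_span_fourier hT 1
  refine ⟨fun z ↦ P.eval z, P.differentiable, fun z hz ↦ ?_⟩
  have hz1 : Complex.exp (z.arg * I) = z := by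
    have := Complex.norm_mul_exp_arg_mul_I z
    rwa [mem_sphere_zero_iff_norm.1 hz, ofReal_one, one_mul] at this
  have h1 : (P.eval z).re = (T (z.arg : ℝ)).re := by
    have := hP z.arg
    rw [hz1, one_mul] at this
    exact this.symm
  have h2 : G (z.arg : ℝ) = g z := by
    have : (AddCircle.toCircle ((z.arg : ℝ) : AddCircle (2 * π)) : ℂ) = z := by
      rw [AddCircle.toCircle_apply_mk, Circle.coe_exp]
      rw [div_self Real.two_pi_pos.ne', one_mul, hz1]
    simp only [G, ContinuousMap.coe_mk, this]
  have h3 : g z = (G (z.arg : ℝ)).re := by rw [h2, ofReal_re]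
  rw [h1, h3, ← sub_re]
  refine (Complex.abs_re_le_norm _).trans_lt (lt_of_le_of_lt ?_ hGT)
  rw [← dist_eq_norm, dist_comm]
  exact ContinuousMap.dist_apply_le_dist _

/-- The minimum principle for `Re F`, obtained from the maximum principle for `exp (-F)`. -/
theorem re_pos_of_forall_sphere {F : ℂ → ℂ} (hF : Differentiable ℂ F)
    (hpos : ∀ z ∈ sphere (0 : ℂ) 1, 0 < (F z).re) {w : ℂ} (hw : w ∈ closedBall (0 : ℂ) 1) :
    0 < (F w).re := by
  obtain ⟨z₀, hz₀, hmin⟩ := (isCompact_sphere (0 : ℂ) 1).exists_isMinOn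
    (NormedSpace.sphere_nonempty.2 zero_le_one)
    ((Complex.continuous_re.comp hF.continuous).continuousOn)
  have key := Complex.norm_le_of_forall_mem_frontier_norm_le (U := ball (0 : ℂ) 1)
    (f := fun z ↦ Complex.exp (-F z)) (C := Real.exp (-(F z₀).re)) isBounded_ball
    (hF.neg.cexp.diffContOnCl) (fun z hz ↦ by
      rw [frontier_ball (0 : ℂ) one_ne_zero] at hz
      rw [Complex.norm_exp, Complex.neg_re]
      exact Real.exp_le_exp.2 (neg_le_neg (hmin hz)))
    (by rw [closure_ball (0 : ℂ) one_ne_zero]; exact hw)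
  rw [Complex.norm_exp, Complex.neg_re, Real.exp_le_exp, neg_le_neg_iff] at key
  exact (hpos z₀ hz₀).trans_le key

/-- The perspective function `(a, b) ↦ ‖a‖² / b` lies above its tangent plane at any point where its
slope in `a` is `2c`; this is its joint convexity. -/
theorem two_mul_re_sub_le_norm_sq_div (a c : ℂ) {b : ℝ} (hb : 0 < b) :
    (2 * (starRingEnd ℂ c * a).re - ‖c‖ ^ 2 * b) ≤ ‖a‖ ^ 2 / b := by
  rw [le_div_iff₀ hb]
  have h : 0 ≤ ‖a - b * c‖ ^ 2 := by positivity
  rw [Complex.sq_norm, Complex.normSq_apply] at h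
  rw [Complex.sq_norm, Complex.normSq_apply, Complex.sq_norm, Complex.normSq_apply]
  simp at h ⊢
  nlinarith

/-! ### Monotonicity of the mean Fisher density -/

/-- If `Re F > 0`, then `‖F'‖² / Re F` satisfies the sub-mean value property with respect to the
Poisson kernel: a jointly convex function of harmonic functions is subharmonic. -/
theorem norm_deriv_sq_div_le_circleAverage {F : ℂ → ℂ} (hF : Differentiable ℂ F) {R : ℝ}
    (hR : 0 < R) (hpos : ∀ z ∈ closedBall (0 : ℂ) R, 0 < (F z).re)
    {w : ℂ} (hw : w ∈ ball (0 : ℂ) R) :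
    ‖deriv F w‖ ^ 2 / (F w).re ≤
      circleAverage (fun z ↦ poissonKernel 0 w z * (‖deriv F z‖ ^ 2 / (F z).re)) 0 R := by
  have hF' : Differentiable ℂ (deriv F) := hF.deriv
  have hfw := hpos w (ball_subset_closedBall hw)
  -- The tangent plane of the perspective function at `(F' w, Re (F w))`, composed with
  -- `(F', Re F)`, is the real part of the entire function `K`, for which the Poisson formula
  -- is an equality.
  set c : ℂ := deriv F w / (F w).re with hc
  set K : ℂ → ℂ := fun z ↦ 2 * (starRingEnd ℂ c * deriv F z) - (‖c‖ ^ 2 : ℝ) * F z with hK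
  have hKd : Differentiable ℂ K := by fun_prop
  have hker : ContinuousOn (poissonKernel 0 w) (sphere 0 R) := by
    rw [poissonKernel_eq_re_herglotzRieszKernel]
    have := continuousOn_herglotzRieszKernel_sphere hw
    rw [abs_of_pos hR] at this
    exact Complex.continuous_re.comp_continuousOn this
  have hKw : (K w).re = ‖deriv F w‖ ^ 2 / (F w).re := by
    have e1 : starRingEnd ℂ c * deriv F w = ((‖deriv F w‖ ^ 2 / (F w).re : ℝ) : ℂ) := by
      rw [hc, map_div₀, Complex.conj_ofReal, div_mul_eq_mul_div, mul_comm, Complex.mul_conj,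
        Complex.normSq_eq_norm_sq]
      push_cast; rfl
    have e2 : ‖c‖ ^ 2 * (F w).re = ‖deriv F w‖ ^ 2 / (F w).re := by
      rw [hc, norm_div, Complex.norm_real, Real.norm_of_nonneg hfw.le]
      field_simp
    rw [hK]
    simp only [Complex.sub_re, Complex.re_ofReal_mul]
    rw [e1, e2, ← Complex.ofReal_ofNat, ← Complex.ofReal_mul, Complex.ofReal_re]
    ring
  have hpois := hKd.diffContOnCl.circleAverage_poissonKernel_smul hw
  have hint : CircleIntegrable (poissonKernel 0 w • K) 0 R :=
    (hker.smul hKd.continuous.continuousOn).circleIntegrable hR.le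
  have hre : circleAverage (fun z ↦ poissonKernel 0 w z * (K z).re) 0 R = (K w).re := by
    have := Complex.reCLM.circleAverage_comp_comm hint
    rw [hpois] at this
    rw [← Complex.reCLM_apply (K w), ← this]
    congr 1
    ext z
    simp
  rw [← hKw, ← hre]
  have hfR : ∀ z ∈ sphere (0 : ℂ) R, 0 < (F z).re := fun z hz ↦ hpos z (sphere_subset_closedBall hz)
  refine circleAverage_mono ?_ ?_ ?_
  · exact (hker.mul (Complex.continuous_re.comp hKd.continuous).continuousOn).circleIntegrable hR.le
  · refine (hker.mul (ContinuousOn.div ?_ ?_ fun z hz ↦ (hfR z hz).ne')).circleIntegrable hR.le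
    · exact (hF'.continuous.norm.pow 2).continuousOn
    · exact (Complex.continuous_re.comp hF.continuous).continuousOn
  · intro z hz
    rw [abs_of_pos hR] at hz
    refine mul_le_mul_of_nonneg_left ?_ ?_
    · refine le_trans (le_of_eq ?_) (two_mul_re_sub_le_norm_sq_div (deriv F z) c (hfR z hz))
      rw [hK]
      simp only [Complex.sub_re, Complex.re_ofReal_mul]
      rw [← Complex.ofReal_ofNat, Complex.re_ofReal_mul]
    · rw [poissonKernel_def]
      have h1 : ‖z‖ = R := mem_sphere_zero_iff_norm.1 hz
      have h2 : ‖w‖ < R := mem_ball_zero_iff.1 hw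
      simp only [sub_zero, h1]
      refine div_nonneg ?_ (by positivity)
      have := norm_nonneg w
      nlinarith

/-- In its interior variable the Poisson kernel is harmonic with value `1` at the centre. -/
theorem circleAverage_poissonKernel_left {r R : ℝ} (hr : 0 ≤ r) (hrR : r < R) {z : ℂ}
    (hz : z ∈ sphere (0 : ℂ) R) :
    circleAverage (fun w ↦ poissonKernel 0 w z) 0 r = 1 := by
  have hzn : ‖z‖ = R := mem_sphere_zero_iff_norm.1 hz
  have hne : ∀ w ∈ closedBall (0 : ℂ) r, z - w ≠ 0 := by
    intro w hw h
    rw [sub_eq_zero] at h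
    rw [mem_closedBall_zero_iff, ← h, hzn] at hw
    exact absurd hrR (not_lt.2 hw)
  have hd : DifferentiableOn ℂ (fun w ↦ (z + w) / (z - w)) (closedBall 0 r) :=
    DifferentiableOn.div (by fun_prop) (by fun_prop) hne
  have hz0 : z ≠ 0 := by
    rintro rfl
    rw [norm_zero] at hzn
    linarith
  have h := (hd.mono closure_ball_subset_closedBall).diffContOnCl
  rw [← abs_of_nonneg hr] at h
  have h := h.circleAverage
  have hint : CircleIntegrable (fun w ↦ (z + w) / (z - w)) 0 r :=
    (hd.continuousOn.mono sphere_subset_closedBall).circleIntegrable hr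
  have := Complex.reCLM.circleAverage_comp_comm hint
  rw [h] at this
  simp only [add_zero, sub_zero, div_self hz0] at this
  rw [Complex.reCLM_apply, Complex.one_re] at this
  rw [← this]
  congr 1
  ext w
  rw [poissonKernel_eq_re_herglotzRieszKernel]
  simp [herglotzRieszKernel_def]

theorem circleAverage_circleAverage_swap {K : ℂ → ℂ → ℝ} {r R : ℝ} (hr : 0 ≤ r) (hR : 0 ≤ R)
    (hK : ContinuousOn (Function.uncurry K) (sphere 0 r ×ˢ sphere 0 R)) :
    circleAverage (fun w ↦ circleAverage (fun z ↦ K w z) 0 R) 0 r =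
      circleAverage (fun z ↦ circleAverage (fun w ↦ K w z) 0 r) 0 R := by
  have hc : Continuous fun p : ℝ × ℝ ↦ K (circleMap 0 r p.1) (circleMap 0 R p.2) :=
    hK.comp_continuous (f := fun p : ℝ × ℝ ↦ (circleMap 0 r p.1, circleMap 0 R p.2))
      (((continuous_circleMap 0 r).comp continuous_fst).prodMk
        ((continuous_circleMap 0 R).comp continuous_snd))
      fun p ↦ ⟨circleMap_mem_sphere 0 hr _, circleMap_mem_sphere 0 hR _⟩
  simp only [circleAverage_def, intervalIntegral.integral_smul]
  rw [intervalIntegral_intervalIntegral_swap]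
  exact (hc.continuousOn.integrableOn_compact (isCompact_uIcc.prod isCompact_uIcc)).mono_set
    (prod_mono uIoc_subset_uIcc uIoc_subset_uIcc)

/-- The circular means of the subharmonic function `‖F'‖² / Re F` increase with the radius. -/
theorem circleAverage_norm_deriv_sq_div_mono {F : ℂ → ℂ} (hF : Differentiable ℂ F) {r R : ℝ}
    (hr : 0 ≤ r) (hrR : r < R) (hpos : ∀ z ∈ closedBall (0 : ℂ) R, 0 < (F z).re) :
    circleAverage (fun z ↦ ‖deriv F z‖ ^ 2 / (F z).re) 0 r ≤
      circleAverage (fun z ↦ ‖deriv F z‖ ^ 2 / (F z).re) 0 R := by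
  have hR : 0 < R := hr.trans_lt hrR
  set G : ℂ → ℝ := fun z ↦ ‖deriv F z‖ ^ 2 / (F z).re with hG
  have hGc : ContinuousOn G (closedBall 0 R) :=
    ContinuousOn.div (hF.deriv.continuous.norm.pow 2).continuousOn
      (Complex.continuous_re.comp hF.continuous).continuousOn fun z hz ↦ (hpos z hz).ne'
  have hsub : sphere (0 : ℂ) r ⊆ ball 0 R := fun w hw ↦ by
    rw [mem_ball_zero_iff, mem_sphere_zero_iff_norm.1 hw]; exact hrR
  have hK : ContinuousOn (Function.uncurry fun w z ↦ poissonKernel 0 w z * G z)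
      (sphere 0 r ×ˢ sphere 0 R) := by
    refine ContinuousOn.mul ?_
      ((hGc.mono sphere_subset_closedBall).comp continuousOn_snd fun p hp ↦ hp.2)
    simp only [poissonKernel_def]
    refine ContinuousOn.div (by fun_prop) (by fun_prop) ?_
    rintro ⟨w, z⟩ ⟨hw, hz⟩ h
    rw [sq_eq_zero_iff, norm_eq_zero, sub_zero, sub_zero, sub_eq_zero] at h
    have h1 := mem_ball_zero_iff.1 (hsub hw)
    rw [← show z = w from h, mem_sphere_zero_iff_norm.1 hz] at h1
    exact lt_irrefl _ h1
  have hcont : ContinuousOn (fun w ↦ circleAverage (fun z ↦ poissonKernel 0 w z * G z) 0 R)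
      (sphere 0 r) := by
    rw [continuousOn_iff_continuous_domRestrict]
    have h2 : Continuous (Function.uncurry fun (w : sphere (0 : ℂ) r) (θ : ℝ) ↦
        poissonKernel 0 (w : ℂ) (circleMap 0 R θ) * G (circleMap 0 R θ)) :=
      hK.comp_continuous (f := fun p : sphere (0 : ℂ) r × ℝ ↦ ((p.1 : ℂ), circleMap 0 R p.2))
        (by fun_prop) fun p ↦ ⟨p.1.2, circleMap_mem_sphere 0 hR.le _⟩
    exact (intervalIntegral.continuous_parametric_intervalIntegral_of_continuous' h2 0
      (2 * π)).const_smul (2 * π)⁻¹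
  calc circleAverage G 0 r
      ≤ circleAverage (fun w ↦ circleAverage (fun z ↦ poissonKernel 0 w z * G z) 0 R) 0 r := by
        refine circleAverage_mono ?_ (hcont.circleIntegrable hr) ?_
        · exact (hGc.mono (hsub.trans ball_subset_closedBall)).circleIntegrable hr
        · intro w hw
          rw [abs_of_nonneg hr] at hw
          exact norm_deriv_sq_div_le_circleAverage hF hR hpos (hsub hw)
    _ = circleAverage (fun z ↦ circleAverage (fun w ↦ poissonKernel 0 w z * G z) 0 r) 0 R :=
        circleAverage_circleAverage_swap hr hR.le hK
    _ = circleAverage G 0 R := by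
        refine circleAverage_congr_sphere fun z hz ↦ ?_
        rw [abs_of_pos hR] at hz
        have := circleAverage_fun_smul (c := (0 : ℂ)) (R := r) (a := G z)
          (f := fun w ↦ poissonKernel 0 w z)
        simp only [smul_eq_mul] at this
        simp only [mul_comm _ (G z)]
        rw [this, circleAverage_poissonKernel_left hr hrR hz, mul_one]

/-! ### Contraction of entropy under harmonic extension -/

/-- Differentiation under the integral sign when integrand and derivative are jointly continuous. -/
theorem hasDerivAt_intervalIntegral_of_continuousOn {g g' : ℝ → ℝ → ℝ} {U : Set ℝ}
    (hU : IsOpen U) {a b : ℝ} (hg : ContinuousOn (Function.uncurry g) (U ×ˢ univ))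
    (hg' : ContinuousOn (Function.uncurry g') (U ×ˢ univ))
    (hd : ∀ r ∈ U, ∀ θ, HasDerivAt (fun r ↦ g r θ) (g' r θ) r) {r₀ : ℝ} (hr₀ : r₀ ∈ U) :
    HasDerivAt (fun r ↦ ∫ θ in a..b, g r θ) (∫ θ in a..b, g' r₀ θ) r₀ := by
  obtain ⟨δ, hδ, hball⟩ := Metric.nhds_basis_closedBall.mem_iff.1 (hU.mem_nhds hr₀)
  have hsec (h : ℝ → ℝ → ℝ) (hh : ContinuousOn (Function.uncurry h) (U ×ˢ univ)) {r : ℝ}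
      (hr : r ∈ U) : Continuous (h r) :=
    hh.comp_continuous (f := fun θ ↦ (r, θ)) (by fun_prop) fun θ ↦ ⟨hr, mem_univ _⟩
  obtain ⟨C, hC⟩ := ((isCompact_closedBall r₀ δ).prod (isCompact_uIcc (a := a) (b := b))
    ).exists_bound_of_continuousOn (hg'.mono (prod_mono hball (subset_univ _)))
  refine (intervalIntegral.hasDerivAt_integral_of_dominated_loc_of_deriv_le (F := g) (F' := g')
    (μ := volume) (bound := fun _ ↦ C) (closedBall_mem_nhds r₀ hδ) ?_ ?_ ?_ ?_ ?_ ?_).2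
  · filter_upwards [hU.mem_nhds hr₀] with r hr
    exact (hsec g hg hr).aestronglyMeasurable
  · exact (hsec g hg hr₀).intervalIntegrable _ _
  · exact (hsec g' hg' hr₀).aestronglyMeasurable
  · exact .of_forall fun θ hθ r hr ↦ hC (r, θ) ⟨hr, uIoc_subset_uIcc hθ⟩
  · exact intervalIntegrable_const
  · exact .of_forall fun θ hθ r hr ↦ hd r (hball hr) θ

theorem hasDerivAt_circleMap_radius (r θ : ℝ) (hr : r ≠ 0) :
    HasDerivAt (fun r : ℝ ↦ circleMap 0 r θ) (circleMap 0 r θ / r) r := by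
  have h := ((Complex.ofRealCLM.hasDerivAt (x := r)).mul_const (Complex.exp (θ * I)))
  have : (r : ℂ) ≠ 0 := by exact_mod_cast hr
  simp only [circleMap, zero_add]
  refine h.congr_deriv ?_
  simp only [Complex.ofRealCLM_apply, ofReal_one]
  field_simp

/-- The Euler operator `z d/dz`. -/
noncomputable def eulerDeriv (F : ℂ → ℂ) (z : ℂ) : ℂ := z * deriv F z

theorem Differentiable.eulerDeriv {F : ℂ → ℂ} (hF : Differentiable ℂ F) :
    Differentiable ℂ (eulerDeriv F) :=
  differentiable_id.mul hF.deriv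

theorem hasDerivAt_comp_circleMap_radius {F : ℂ → ℂ} (hF : Differentiable ℂ F) (r θ : ℝ)
    (hr : r ≠ 0) :
    HasDerivAt (fun r : ℝ ↦ F (circleMap 0 r θ)) (eulerDeriv F (circleMap 0 r θ) / r) r := by
  have h := HasDerivAt.comp_of_eq (h₂ := F) r (hF _).hasDerivAt
    (hasDerivAt_circleMap_radius r θ hr) rfl
  refine h.congr_deriv ?_
  rw [_root_.eulerDeriv]
  ring

theorem hasDerivAt_comp_circleMap_angle {F : ℂ → ℂ} (hF : Differentiable ℂ F) (r θ : ℝ) :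
    HasDerivAt (fun θ : ℝ ↦ F (circleMap 0 r θ)) (eulerDeriv F (circleMap 0 r θ) * I) θ := by
  have h := HasDerivAt.comp_of_eq (h₂ := F) θ (hF _).hasDerivAt (hasDerivAt_circleMap 0 r θ) rfl
  refine h.congr_deriv ?_
  rw [_root_.eulerDeriv]
  ring

theorem hasDerivAt_re_of_complex {g : ℝ → ℂ} {g' : ℂ} {x : ℝ} (h : HasDerivAt g g' x) :
    HasDerivAt (fun x ↦ (g x).re) g'.re x :=
  Complex.reCLM.hasFDerivAt.comp_hasDerivAt x h

theorem hasDerivAt_im_of_complex {g : ℝ → ℂ} {g' : ℂ} {x : ℝ} (h : HasDerivAt g g' x) :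
    HasDerivAt (fun x ↦ (g x).im) g'.im x :=
  Complex.imCLM.hasFDerivAt.comp_hasDerivAt x h

theorem circleAverage_re {F : ℂ → ℂ} (hF : Differentiable ℂ F) (r : ℝ) :
    circleAverage (fun z ↦ (F z).re) 0 r = (F 0).re := by
  have := Complex.reCLM.circleAverage_comp_comm (f := F) (c := 0) (R := r)
    (hF.continuous.continuousOn.circleIntegrable')
  rw [hF.diffContOnCl.circleAverage] at this
  exact this

/-- Integration by parts in the angle, in which `∂/∂θ` acts on analytic functions as `I` times the
Euler operator; there is no boundary term because of periodicity. -/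
theorem circleAverage_log_mul_re_eulerDeriv_eulerDeriv {F : ℂ → ℂ} (hF : Differentiable ℂ F) {r : ℝ}
    (hr : 0 ≤ r) (hpos : ∀ z ∈ sphere (0 : ℂ) r, 0 < (F z).re) :
    circleAverage (fun z ↦ Real.log (F z).re * (eulerDeriv (eulerDeriv F) z).re) 0 r =
      circleAverage (fun z ↦ (eulerDeriv F z).im ^ 2 / (F z).re) 0 r := by
  have hp (θ : ℝ) : 0 < (F (circleMap 0 r θ)).re := hpos _ (circleMap_mem_sphere 0 hr θ)
  have hD := hF.eulerDeriv
  have hDD := hD.eulerDeriv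
  have hd (θ : ℝ) : HasDerivAt
      (fun θ : ℝ ↦ Real.log (F (circleMap 0 r θ)).re * (eulerDeriv F (circleMap 0 r θ)).im)
      (Real.log (F (circleMap 0 r θ)).re * (eulerDeriv (eulerDeriv F) (circleMap 0 r θ)).re -
        (eulerDeriv F (circleMap 0 r θ)).im ^ 2 / (F (circleMap 0 r θ)).re) θ := by
    have h1 := (hasDerivAt_re_of_complex (hasDerivAt_comp_circleMap_angle hF r θ)).log (hp θ).ne'
    have h2 := hasDerivAt_im_of_complex (hasDerivAt_comp_circleMap_angle hD r θ)
    refine (h1.mul h2).congr_deriv ?_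
    simp only [Complex.mul_re, Complex.mul_im, I_re, I_im]
    ring
  have c1 : Continuous fun θ : ℝ ↦
      Real.log (F (circleMap 0 r θ)).re * (eulerDeriv (eulerDeriv F) (circleMap 0 r θ)).re := by
    refine Continuous.mul (Continuous.log ?_ fun θ ↦ (hp θ).ne') ?_
    · exact Complex.continuous_re.comp (hF.continuous.comp (continuous_circleMap 0 r))
    · exact Complex.continuous_re.comp (hDD.continuous.comp (continuous_circleMap 0 r))
  have c2 : Continuous fun θ : ℝ ↦
      (eulerDeriv F (circleMap 0 r θ)).im ^ 2 / (F (circleMap 0 r θ)).re := by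
    refine Continuous.div (Continuous.pow ?_ 2) ?_ fun θ ↦ (hp θ).ne'
    · exact Complex.continuous_im.comp (hD.continuous.comp (continuous_circleMap 0 r))
    · exact Complex.continuous_re.comp (hF.continuous.comp (continuous_circleMap 0 r))
  have h := intervalIntegral.integral_eq_sub_of_hasDerivAt (a := 0) (b := 2 * π)
    (fun θ _ ↦ hd θ) ((c1.sub c2).intervalIntegrable _ _)
  rw [intervalIntegral.integral_sub (c1.intervalIntegrable _ _) (c2.intervalIntegrable _ _)] at h
  have hper : circleMap 0 r (2 * π) = circleMap 0 r 0 := by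
    simpa using (periodic_circleMap 0 r) 0
  rw [hper, sub_self, sub_eq_zero] at h
  rw [circleAverage_def, circleAverage_def, h]

/-- The radial derivative of a circular mean, for a function whose `r ∂/∂r` is known. -/
theorem hasDerivAt_circleAverage_radius {G G' : ℂ → ℝ} (hG : ContinuousOn G (closedBall 0 1))
    (hG' : ContinuousOn G' (closedBall 0 1))
    (hd : ∀ r ∈ Ioo (0 : ℝ) 1, ∀ θ,
      HasDerivAt (fun r ↦ G (circleMap 0 r θ)) (G' (circleMap 0 r θ) / r) r)
    {r : ℝ} (hr : r ∈ Ioo (0 : ℝ) 1) :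
    HasDerivAt (circleAverage G 0) (circleAverage G' 0 r / r) r := by
  have hmaps : MapsTo (fun p : ℝ × ℝ ↦ circleMap 0 p.1 p.2) (Ioo 0 1 ×ˢ univ)
      (closedBall (0 : ℂ) 1) := by
    rintro ⟨r, θ⟩ ⟨hr, -⟩
    simp [abs_of_pos hr.1, hr.2.le]
  have hc : ContinuousOn (fun p : ℝ × ℝ ↦ circleMap 0 p.1 p.2) (Ioo (0 : ℝ) 1 ×ˢ univ) :=
    circleMap.continuous.continuousOn
  have h := hasDerivAt_intervalIntegral_of_continuousOn (a := 0) (b := 2 * π)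
    (g := fun r θ ↦ G (circleMap 0 r θ)) (g' := fun r θ ↦ G' (circleMap 0 r θ) / r) isOpen_Ioo
    (hG.comp hc hmaps)
    ((hG'.comp hc hmaps).div continuous_fst.continuousOn fun p hp ↦ hp.1.1.ne') hd hr
  refine (h.const_smul (2 * π)⁻¹).congr_deriv ?_
  rw [intervalIntegral.integral_div, circleAverage_def, smul_eq_mul, smul_eq_mul, mul_div_assoc]

/-- The radial derivative of the entropy. The contribution of the `1` in `(x log x)' = log x + 1`
drops out, since the Euler derivative of `F` vanishes at the origin. -/
theorem hasDerivAt_circleAverage_mul_log {F : ℂ → ℂ} (hF : Differentiable ℂ F)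
    (hpos : ∀ z ∈ closedBall (0 : ℂ) 1, 0 < (F z).re) {r : ℝ} (hr : r ∈ Ioo (0 : ℝ) 1) :
    HasDerivAt (circleAverage (fun z ↦ (F z).re * Real.log (F z).re) 0)
      (circleAverage (fun z ↦ Real.log (F z).re * (eulerDeriv F z).re) 0 r / r) r := by
  have hf : ContinuousOn (fun z ↦ (F z).re) (closedBall 0 1) :=
    (Complex.continuous_re.comp hF.continuous).continuousOn
  have hD : ContinuousOn (fun z ↦ (eulerDeriv F z).re) (closedBall 0 1) :=
    (Complex.continuous_re.comp hF.eulerDeriv.continuous).continuousOn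
  have hlog : ContinuousOn (fun z ↦ Real.log (F z).re) (closedBall 0 1) :=
    hf.log fun z hz ↦ (hpos z hz).ne'
  have hsub : sphere (0 : ℂ) r ⊆ closedBall 0 1 :=
    sphere_subset_closedBall.trans (closedBall_subset_closedBall hr.2.le)
  refine (hasDerivAt_circleAverage_radius
    (G' := fun z ↦ Real.log (F z).re * (eulerDeriv F z).re + (eulerDeriv F z).re)
    (hf.mul hlog) ((hlog.mul hD).add hD) (fun s hs θ ↦ ?_) hr).congr_deriv ?_
  · have hz := hpos _ (show circleMap 0 s θ ∈ closedBall (0 : ℂ) 1 by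
      simp [abs_of_pos hs.1, hs.2.le])
    have h := hasDerivAt_re_of_complex (hasDerivAt_comp_circleMap_radius hF s θ hs.1.ne')
    refine (h.mul (h.log hz.ne')).congr_deriv ?_
    rw [Complex.div_ofReal_re]
    field_simp
  · rw [circleAverage_fun_add, circleAverage_re hF.eulerDeriv]
    · simp [_root_.eulerDeriv]
    · exact ((hlog.mul hD).mono hsub).circleIntegrable hr.1.le
    · exact (hD.mono hsub).circleIntegrable hr.1.le

/-- The derivative of `r E'(r)`, for the entropy `E(r)` on the circle of radius `r`: it is `r`
times the mean of `‖F'‖² / Re F`, the Laplacian of `f log f` for `f = Re F`. -/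
theorem hasDerivAt_circleAverage_log_mul_re {F : ℂ → ℂ} (hF : Differentiable ℂ F)
    (hpos : ∀ z ∈ closedBall (0 : ℂ) 1, 0 < (F z).re) {r : ℝ} (hr : r ∈ Ioo (0 : ℝ) 1) :
    HasDerivAt (circleAverage (fun z ↦ Real.log (F z).re * (eulerDeriv F z).re) 0)
      (r * circleAverage (fun z ↦ ‖deriv F z‖ ^ 2 / (F z).re) 0 r) r := by
  have hf : ContinuousOn (fun z ↦ (F z).re) (closedBall 0 1) :=
    (Complex.continuous_re.comp hF.continuous).continuousOn
  have hD : ContinuousOn (fun z ↦ (eulerDeriv F z).re) (closedBall 0 1) :=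
    (Complex.continuous_re.comp hF.eulerDeriv.continuous).continuousOn
  have hDi : ContinuousOn (fun z ↦ (eulerDeriv F z).im) (closedBall 0 1) :=
    (Complex.continuous_im.comp hF.eulerDeriv.continuous).continuousOn
  have hDD : ContinuousOn (fun z ↦ (eulerDeriv (eulerDeriv F) z).re) (closedBall 0 1) :=
    (Complex.continuous_re.comp hF.eulerDeriv.eulerDeriv.continuous).continuousOn
  have hlog : ContinuousOn (fun z ↦ Real.log (F z).re) (closedBall 0 1) :=
    hf.log fun z hz ↦ (hpos z hz).ne'
  have hsub : sphere (0 : ℂ) r ⊆ closedBall 0 1 :=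
    sphere_subset_closedBall.trans (closedBall_subset_closedBall hr.2.le)
  have hq : ContinuousOn (fun z ↦ (eulerDeriv F z).re ^ 2 / (F z).re) (closedBall 0 1) :=
    (hD.pow 2).div hf fun z hz ↦ (hpos z hz).ne'
  have hqi : ContinuousOn (fun z ↦ (eulerDeriv F z).im ^ 2 / (F z).re) (closedBall 0 1) :=
    (hDi.pow 2).div hf fun z hz ↦ (hpos z hz).ne'
  have hl : ContinuousOn (fun z ↦ Real.log (F z).re * (eulerDeriv (eulerDeriv F) z).re)
      (closedBall 0 1) := hlog.mul hDD
  refine (hasDerivAt_circleAverage_radius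
    (G' := fun z ↦ (eulerDeriv F z).re ^ 2 / (F z).re +
      Real.log (F z).re * (eulerDeriv (eulerDeriv F) z).re)
    (hlog.mul hD) (hq.add hl) (fun s hs θ ↦ ?_) hr).congr_deriv ?_
  · have hz := hpos _ (show circleMap 0 s θ ∈ closedBall (0 : ℂ) 1 by
      simp [abs_of_pos hs.1, hs.2.le])
    have h := hasDerivAt_re_of_complex (hasDerivAt_comp_circleMap_radius hF s θ hs.1.ne')
    have h' := hasDerivAt_re_of_complex
      (hasDerivAt_comp_circleMap_radius hF.eulerDeriv s θ hs.1.ne')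
    refine ((h.log hz.ne').mul h').congr_deriv ?_
    rw [Complex.div_ofReal_re, Complex.div_ofReal_re]
    ring
  · rw [circleAverage_fun_add ((hq.mono hsub).circleIntegrable hr.1.le)
      ((hl.mono hsub).circleIntegrable hr.1.le),
      circleAverage_log_mul_re_eulerDeriv_eulerDeriv hF hr.1.le fun z hz ↦ hpos z (hsub hz),
      ← circleAverage_fun_add ((hq.mono hsub).circleIntegrable hr.1.le)
      ((hqi.mono hsub).circleIntegrable hr.1.le), div_eq_iff hr.1.ne']
    have h1 : r * circleAverage (fun z ↦ ‖deriv F z‖ ^ 2 / (F z).re) 0 r * r =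
        circleAverage (fun z ↦ r ^ 2 * (‖deriv F z‖ ^ 2 / (F z).re)) 0 r := by
      have := circleAverage_fun_smul (c := (0 : ℂ)) (R := r) (a := r ^ 2)
        (f := fun z ↦ ‖deriv F z‖ ^ 2 / (F z).re)
      simp only [smul_eq_mul] at this
      rw [this]
      ring
    rw [h1]
    refine circleAverage_congr_sphere fun z hz ↦ ?_
    rw [abs_of_pos hr.1, mem_sphere_zero_iff_norm] at hz
    rw [← hz, ← mul_div_assoc, ← mul_pow, ← norm_mul, ← add_div, Complex.sq_norm,
      Complex.normSq_apply, _root_.eulerDeriv]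
    ring

/-- Contraction of entropy. If `f = Re F` is positive on the unit circle, then passing to the
circle of radius `ρ` multiplies the entropy `avg (f log f) - (avg f) log (avg f)` by at most `ρ²`;
note that the mean of `f` over each of these circles is `Re (F 0)`. -/
theorem entropy_circleAverage_le {F : ℂ → ℂ} (hF : Differentiable ℂ F)
    (hpos : ∀ z ∈ sphere (0 : ℂ) 1, 0 < (F z).re) {ρ : ℝ} (hρ : 0 < ρ) (hρ1 : ρ ≤ 1) :
    circleAverage (fun z ↦ (F z).re * Real.log (F z).re) 0 ρ - (F 0).re * Real.log (F 0).re ≤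
      ρ ^ 2 * (circleAverage (fun z ↦ (F z).re * Real.log (F z).re) 0 1 -
        (F 0).re * Real.log (F 0).re) := by
  have hpos : ∀ z ∈ closedBall (0 : ℂ) 1, 0 < (F z).re :=
    fun z hz ↦ re_pos_of_forall_sphere hF hpos hz
  set E := circleAverage (fun z ↦ (F z).re * Real.log (F z).re) 0 with hE
  set A := circleAverage (fun z ↦ Real.log (F z).re * (eulerDeriv F z).re) 0 with hA
  set M := circleAverage (fun z ↦ ‖deriv F z‖ ^ 2 / (F z).re) 0 with hM
  have hf : ContinuousOn (fun z ↦ (F z).re) (closedBall 0 1) :=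
    (Complex.continuous_re.comp hF.continuous).continuousOn
  have hlog : ContinuousOn (fun z ↦ Real.log (F z).re) (closedBall 0 1) :=
    hf.log fun z hz ↦ (hpos z hz).ne'
  have hcont {G : ℂ → ℝ} (hG : ContinuousOn G (closedBall 0 1)) :
      ContinuousOn (circleAverage G 0) (Icc 0 1) :=
    ContinuousOn.circleAverage (hG.mono fun z hz ↦ by simpa using hz.2) fun r hr ↦ hr.1
  have hEc : ContinuousOn E (Icc 0 1) := hcont (hf.mul hlog)
  have hAc : ContinuousOn A (Icc 0 1) := hcont (hlog.mul
    (Complex.continuous_re.comp hF.eulerDeriv.continuous).continuousOn)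
  have hEd : ∀ r ∈ Ioo (0 : ℝ) 1, HasDerivAt E (A r / r) r :=
    fun r hr ↦ hasDerivAt_circleAverage_mul_log hF hpos hr
  have hAd : ∀ r ∈ Ioo (0 : ℝ) 1, HasDerivAt A (r * M r) r :=
    fun r hr ↦ hasDerivAt_circleAverage_log_mul_re hF hpos hr
  have hE0 : E 0 = (F 0).re * Real.log (F 0).re := by rw [hE, circleAverage_zero]
  have hA0 : A 0 = 0 := by rw [hA, circleAverage_zero]; simp [_root_.eulerDeriv]
  -- Notation: `r E' = A` and `A' = r M` with `M` nondecreasing. Hence `A ≤ r² M / 2`, then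
  -- `2 (E - E 0) ≤ A = r E'`, and this says that `(E - E 0) / r²` is nondecreasing.
  have hMm : ∀ r ∈ Ioo (0 : ℝ) 1, ∀ R ∈ Ioo (0 : ℝ) 1, r < R → M r ≤ M R := fun r hr R hR h ↦
    circleAverage_norm_deriv_sq_div_mono hF hr.1.le h fun z hz ↦
      hpos z (closedBall_subset_closedBall hR.2.le hz)
  have hAM : ∀ R ∈ Ioo (0 : ℝ) 1, A R ≤ R ^ 2 * M R / 2 := by
    intro R hR
    have hmono : MonotoneOn (fun r ↦ r ^ 2 * M R / 2 - A r) (Icc 0 R) := by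
      refine monotoneOn_of_hasDerivWithinAt_nonneg (f' := fun r ↦ r * (M R - M r))
        (convex_Icc 0 R) ?_ ?_ ?_
      · exact (by fun_prop : Continuous fun r ↦ r ^ 2 * M R / 2).continuousOn.sub
          (hAc.mono (Icc_subset_Icc_right hR.2.le))
      · intro r hr
        rw [interior_Icc] at hr
        refine HasDerivAt.hasDerivWithinAt ?_
        refine ((((hasDerivAt_pow 2 r).mul_const (M R)).div_const 2).sub
          (hAd r ⟨hr.1, hr.2.trans hR.2⟩)).congr_deriv ?_
        push_cast
        ring
      · intro r hr
        rw [interior_Icc] at hr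
        exact mul_nonneg hr.1.le (sub_nonneg.2 (hMm r ⟨hr.1, hr.2.trans hR.2⟩ R hR hr.2))
    have := hmono (left_mem_Icc.2 hR.1.le) (right_mem_Icc.2 hR.1.le) hR.1.le
    simp only [hA0] at this
    linarith
  have hAE : ∀ R ∈ Icc (0 : ℝ) 1, 2 * (E R - E 0) ≤ A R := by
    have hmono : MonotoneOn (fun r ↦ A r - 2 * (E r - E 0)) (Icc 0 1) := by
      refine monotoneOn_of_hasDerivWithinAt_nonneg (f' := fun r ↦ r * M r - 2 * (A r / r))
        (convex_Icc 0 1) ?_ ?_ ?_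
      · exact hAc.sub (continuousOn_const.mul (hEc.sub continuousOn_const))
      · intro r hr
        rw [interior_Icc] at hr
        exact ((hAd r hr).sub (((hEd r hr).sub_const (E 0)).const_mul 2)).hasDerivWithinAt
      · intro r hr
        rw [interior_Icc] at hr
        have h1 := hAM r hr
        have h2 : A r / r ≤ r * M r / 2 := by
          rw [div_le_iff₀ hr.1]
          linarith
        linarith
    intro R hR
    have := hmono (left_mem_Icc.2 zero_le_one) hR hR.1
    simp only [hA0] at this
    linarith
  have hmono : MonotoneOn (fun r ↦ (E r - E 0) / r ^ 2) (Icc ρ 1) := by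
    refine monotoneOn_of_hasDerivWithinAt_nonneg
      (f' := fun r ↦ (A r / r * r ^ 2 - (E r - E 0) * (2 * r)) / (r ^ 2) ^ 2)
      (convex_Icc ρ 1) ?_ ?_ ?_
    · exact ((hEc.mono (Icc_subset_Icc_left hρ.le)).sub continuousOn_const).div
        (continuous_pow 2).continuousOn fun r hr ↦ (pow_pos (hρ.trans_le hr.1) 2).ne'
    · intro r hr
      rw [interior_Icc] at hr
      have hr0 : 0 < r := hρ.trans hr.1
      refine (((hEd r ⟨hr0, hr.2⟩).sub_const (E 0)).div (hasDerivAt_pow 2 r)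
        (pow_pos hr0 2).ne').hasDerivWithinAt.congr_deriv ?_
      push_cast
      ring
    · intro r hr
      rw [interior_Icc] at hr
      have hr0 : 0 < r := hρ.trans hr.1
      refine div_nonneg ?_ (by positivity)
      have h := hAE r ⟨hr0.le, hr.2.le⟩
      have : A r / r * r ^ 2 - (E r - E 0) * (2 * r) = r * (A r - 2 * (E r - E 0)) := by
        field_simp
      rw [this]
      exact mul_nonneg hr0.le (sub_nonneg.2 h)
  have := hmono (left_mem_Icc.2 hρ1) (right_mem_Icc.2 hρ1) hρ1
  simp only [one_pow, div_one] at this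
  rw [div_le_iff₀ (by positivity)] at this
  rw [← hE0]
  linarith

/-! ### Duality between dilation and the Gibbs inequality -/

theorem circleAverage_eq_circleAverage_comp_mul {E : Type*} [NormedAddCommGroup E]
    [NormedSpace ℝ E] (f : ℂ → E) (r : ℝ) :
    circleAverage f 0 r = circleAverage (fun z ↦ f (r * z)) 0 1 := by
  rw [circleAverage_eq_circleAverage_zero_one]
  simp

/-- Circular means of a function analytic off the origin do not depend on the radius. -/
theorem circleAverage_eq_of_differentiableOn_punctured {K : ℂ → ℂ}
    (hK : DifferentiableOn ℂ K {0}ᶜ) {ρ : ℝ} (hρ : 0 < ρ) (hρ1 : ρ ≤ 1) :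
    circleAverage K 0 1 = circleAverage K 0 ρ := by
  rw [circleAverage_eq_circleIntegral one_ne_zero, circleAverage_eq_circleIntegral hρ.ne']
  congr 1
  refine Complex.circleIntegral_sub_center_inv_smul_eq_of_differentiable_on_annulus_off_countable
    hρ hρ1 countable_empty (hK.continuousOn.mono ?_) ?_
  · rintro z ⟨-, hz⟩ rfl
    exact hz (mem_ball_self hρ)
  · rintro z ⟨⟨-, hz⟩, -⟩
    refine hK.differentiableAt (isOpen_compl_singleton.mem_nhds ?_)
    rintro rfl
    exact hz (mem_closedBall_self hρ.le)

/-- Dilation of analytic functions is self-adjoint for the sesquilinear pairing on the circle.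
There, `conj (H (ρ z))` is the boundary value of the function `conj (H (conj (ρ / z)))`, which is
analytic off the origin, so the contour may be moved to radius `ρ`. -/
theorem circleAverage_mul_conj_dilation {F H : ℂ → ℂ} (hF : Differentiable ℂ F)
    (hH : Differentiable ℂ H) {ρ : ℝ} (hρ : 0 < ρ) (hρ1 : ρ ≤ 1) :
    circleAverage (fun z ↦ F z * starRingEnd ℂ (H (ρ * z))) 0 1 =
      circleAverage (fun z ↦ F (ρ * z) * starRingEnd ℂ (H z)) 0 1 := by
  have hinv : ∀ z ∈ sphere (0 : ℂ) |1|, starRingEnd ℂ z = z⁻¹ := by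
    intro z hz
    rw [abs_one, mem_sphere_zero_iff_norm] at hz
    rw [Complex.inv_def, Complex.normSq_eq_norm_sq, hz]
    simp
  have hHs : Differentiable ℂ (starRingEnd ℂ ∘ H ∘ starRingEnd ℂ) := fun z ↦ by
    rw [differentiableAt_conj_conj_iff]
    exact hH _
  have hK : DifferentiableOn ℂ (fun z ↦ F z * (starRingEnd ℂ ∘ H ∘ starRingEnd ℂ) (ρ * z⁻¹))
      {0}ᶜ := by
    refine hF.differentiableOn.mul (hHs.comp_differentiableOn ?_)
    exact (differentiableOn_inv.mono fun z hz ↦ hz).const_mul _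
  have h := circleAverage_eq_of_differentiableOn_punctured hK hρ hρ1
  rw [circleAverage_eq_circleAverage_comp_mul _ ρ] at h
  refine (circleAverage_congr_sphere fun z hz ↦ ?_).trans
    (h.trans (circleAverage_congr_sphere fun z hz ↦ ?_))
  · simp [← hinv z hz]
  · have : (ρ : ℂ) ≠ 0 := by exact_mod_cast hρ.ne'
    simp only [Function.comp_apply]
    rw [mul_inv, ← hinv z hz, mul_inv_cancel_left₀ this, Complex.conj_conj]

/-- Harmonic extension to the radius `ρ` is a self-adjoint operator on the circle. -/
theorem circleAverage_re_mul_re_dilation {F H : ℂ → ℂ} (hF : Differentiable ℂ F)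
    (hH : Differentiable ℂ H) {ρ : ℝ} (hρ : 0 < ρ) (hρ1 : ρ ≤ 1) :
    circleAverage (fun z ↦ (F z).re * (H (ρ * z)).re) 0 1 =
      circleAverage (fun z ↦ (F (ρ * z)).re * (H z).re) 0 1 := by
  have key {A B : ℂ → ℂ} (hA : Differentiable ℂ A) (hB : Differentiable ℂ B) :
      circleAverage (fun z ↦ (A z).re * (B z).re) 0 1 =
        ((A 0 * B 0).re + (circleAverage (fun z ↦ A z * starRingEnd ℂ (B z)) 0 1).re) / 2 := by
    have hc : Continuous fun z ↦ A z * starRingEnd ℂ (B z) :=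
      hA.continuous.mul (Complex.continuous_conj.comp hB.continuous)
    have h1 := circleAverage_re (hA.mul hB) 1
    have h2 := Complex.reCLM.circleAverage_comp_comm (c := 0) (R := 1)
      (hc.continuousOn.circleIntegrable')
    rw [Complex.reCLM_apply] at h2
    simp only [Pi.mul_apply] at h1
    rw [← h1, ← h2, ← circleAverage_add, eq_div_iff two_ne_zero, mul_comm, ← smul_eq_mul,
      ← circleAverage_fun_smul]
    · congr 1
      ext z
      simp
      ring
    · exact (Complex.continuous_re.comp (hA.mul hB).continuous).continuousOn.circleIntegrable'
    · exact (Complex.continuous_re.comp hc).continuousOn.circleIntegrable'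
  have hd : Differentiable ℂ fun z : ℂ ↦ ρ * z := by fun_prop
  have e1 := key hF (hH.comp hd)
  have e2 := key (hF.comp hd) hH
  simp only [Function.comp_apply] at e1 e2
  rw [e1, e2]
  have := circleAverage_mul_conj_dilation hF hH hρ hρ1
  rw [this, mul_zero]

theorem circleAverage_pos {f : ℂ → ℝ} (hf : ContinuousOn f (sphere 0 1))
    (hpos : ∀ z ∈ sphere (0 : ℂ) 1, 0 < f z) : 0 < circleAverage f 0 1 := by
  obtain ⟨z₀, hz₀, hmin⟩ := (isCompact_sphere (0 : ℂ) 1).exists_isMinOn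
    (NormedSpace.sphere_nonempty.2 zero_le_one) hf
  have := circleAverage_mono (circleIntegrable_const (f z₀) 0 1)
    (hf.circleIntegrable zero_le_one) fun z hz ↦ hmin (by simpa using hz)
  rw [circleAverage_const] at this
  exact (hpos z₀ hz₀).trans_le this

/-- The Gibbs variational inequality: log-integrals of exponentials dominate linear functionals
minus entropy. -/
theorem gibbs_circleAverage {f φ : ℂ → ℝ} (hf : ContinuousOn f (sphere 0 1))
    (hpos : ∀ z ∈ sphere (0 : ℂ) 1, 0 < f z) (hφ : ContinuousOn φ (sphere 0 1)) :
    circleAverage (fun z ↦ f z * φ z) 0 1 -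
        (circleAverage (fun z ↦ f z * Real.log (f z)) 0 1 -
          circleAverage f 0 1 * Real.log (circleAverage f 0 1)) ≤
      circleAverage f 0 1 * Real.log (circleAverage (fun z ↦ Real.exp (φ z)) 0 1) := by
  have hexp : ContinuousOn (fun z ↦ Real.exp (φ z)) (sphere 0 1) := hφ.rexp
  have hlog : ContinuousOn (fun z ↦ f z * Real.log (f z)) (sphere 0 1) :=
    hf.mul (hf.log fun z hz ↦ (hpos z hz).ne')
  have hfφ : ContinuousOn (fun z ↦ f z * φ z) (sphere 0 1) := hf.mul hφ
  have I {g : ℂ → ℝ} (hg : ContinuousOn g (sphere 0 1)) : CircleIntegrable g 0 1 :=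
    hg.circleIntegrable zero_le_one
  have S (k : ℝ) (g : ℂ → ℝ) : circleAverage (fun z ↦ k * g z) 0 1 = k * circleAverage g 0 1 := by
    have := circleAverage_fun_smul (c := (0 : ℂ)) (R := 1) (a := k) (f := g)
    simpa only [smul_eq_mul] using this
  have c1 (k : ℝ) {g : ℂ → ℝ} (hg : ContinuousOn g (sphere 0 1)) :
      ContinuousOn (fun z ↦ k * g z) (sphere 0 1) := continuousOn_const.mul hg
  set a := circleAverage f 0 1 with ha
  set Z := circleAverage (fun z ↦ Real.exp (φ z)) 0 1 with hZ
  have ha0 : 0 < a := circleAverage_pos hf hpos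
  have hZ0 : 0 < Z := circleAverage_pos hexp fun z _ ↦ Real.exp_pos _
  -- The scale at which `k exp φ` has the same mean as `f`, so that the linear terms cancel below.
  set k := a / Z with hk
  have hk0 : 0 < k := div_pos ha0 hZ0
  have c2 : ContinuousOn (fun z ↦ k * Real.exp (φ z) - f z) (sphere 0 1) := (c1 _ hexp).sub hf
  have hmono := circleAverage_mono (c := 0) (R := 1)
    (f₁ := fun z ↦ f z * φ z + Real.log k * f z)
    (f₂ := fun z ↦ k * Real.exp (φ z) - f z + f z * Real.log (f z))
    (I (hfφ.add (c1 _ hf))) (I (c2.add hlog)) (by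
      intro z hz
      rw [abs_one] at hz
      have hfz := hpos z hz
      have h := Real.log_le_sub_one_of_pos
        (show 0 < k * Real.exp (φ z) / f z by positivity)
      rw [Real.log_div (by positivity) hfz.ne', Real.log_mul hk0.ne' (Real.exp_ne_zero _),
        Real.log_exp, div_sub_one hfz.ne', le_div_iff₀ hfz] at h
      linarith)
  rw [circleAverage_fun_add (I hfφ) (I (c1 _ hf)), S,
    circleAverage_fun_add (I c2) (I hlog),
    circleAverage_fun_sub (I (c1 _ hexp)) (I hf), S, ← ha, ← hZ] at hmono
  have h1 : k * Z = a := div_mul_cancel₀ _ hZ0.ne'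
  have h2 : Real.log k = Real.log a - Real.log Z := Real.log_div ha0.ne' hZ0.ne'
  rw [h1, h2] at hmono
  linarith

/-! ### Hypercontractivity in one variable -/

/-- A positive continuous function `exp φ` on the circle is approximated by real parts of entire
functions up to a factor as close to `1` as desired. -/
theorem exists_differentiable_re_mem_exp_Icc {φ : ℂ → ℝ} (hφ : ContinuousOn φ (sphere 0 1))
    {δ : ℝ} (hδ : 0 < δ) :
    ∃ F : ℂ → ℂ, Differentiable ℂ F ∧ ∀ z ∈ sphere (0 : ℂ) 1,
      (F z).re ∈ Icc (Real.exp (φ z - δ)) (Real.exp (φ z + δ)) := by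
  obtain ⟨z₀, hz₀, hmin⟩ := (isCompact_sphere (0 : ℂ) 1).exists_isMinOn
    (NormedSpace.sphere_nonempty.2 zero_le_one) hφ
  have h1 : 0 < 1 - Real.exp (-δ) := by
    rw [sub_pos, Real.exp_lt_one_iff]
    linarith
  obtain ⟨F, hF, hFφ⟩ := exists_differentiable_abs_re_sub_lt hφ.rexp
    (mul_pos (Real.exp_pos (φ z₀)) h1)
  refine ⟨F, hF, fun z hz ↦ ?_⟩
  have h := abs_lt.1 (hFφ z hz)
  have h2 : Real.exp (φ z₀) * (1 - Real.exp (-δ)) ≤ Real.exp (φ z) * (1 - Real.exp (-δ)) :=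
    mul_le_mul_of_nonneg_right (Real.exp_le_exp.2 (hmin hz)) h1.le
  have h3 : 1 - Real.exp (-δ) ≤ Real.exp δ - 1 := by
    have e1 := Real.add_one_le_exp δ
    have e2 := Real.add_one_le_exp (-δ)
    have e3 : Real.exp δ * Real.exp (-δ) = 1 := by
      rw [← Real.exp_add, add_neg_cancel, Real.exp_zero]
    nlinarith [sq_nonneg (Real.exp δ - 1), Real.exp_pos (-δ)]
  have h4 : Real.exp (φ z) * (1 - Real.exp (-δ)) ≤ Real.exp (φ z) * (Real.exp δ - 1) :=
    mul_le_mul_of_nonneg_left h3 (Real.exp_pos _).le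
  rw [sub_eq_add_neg (φ z), Real.exp_add, Real.exp_add]
  constructor <;> linarith

/-- Hypercontractivity for exponentials of harmonic functions. It is dual to the contraction of
entropy, through the Gibbs inequality for the function `exp (p Re H)` at a density close to the
optimal one for `exp (q Re H)` on the smaller circle. -/
theorem circleAverage_exp_mul_re_le {H : ℂ → ℂ} (hH : Differentiable ℂ H) {p q : ℝ} (hp : 0 < p)
    (hpq : p ≤ q) :
    circleAverage (fun z ↦ Real.exp (q * (H z).re)) 0 √(p / q) ≤
      circleAverage (fun z ↦ Real.exp (p * (H z).re)) 0 1 ^ (q / p) := by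
  have hq : 0 < q := hp.trans_le hpq
  set ρ := √(p / q) with hρ
  have hρ0 : 0 < ρ := Real.sqrt_pos.2 (div_pos hp hq)
  have hρ2 : ρ ^ 2 = p / q := Real.sq_sqrt (div_pos hp hq).le
  have hρ1 : ρ ≤ 1 := by
    rw [hρ, Real.sqrt_le_one]
    exact (div_le_one hq).2 hpq
  have hd : Differentiable ℂ fun z : ℂ ↦ (ρ : ℂ) * z := by fun_prop
  have cre {G : ℂ → ℂ} (hG : Differentiable ℂ G) (s : Set ℂ) :
      ContinuousOn (fun z ↦ (G z).re) s := (Complex.continuous_re.comp hG.continuous).continuousOn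
  have S (k : ℝ) (g : ℂ → ℝ) : circleAverage (fun z ↦ k * g z) 0 1 = k * circleAverage g 0 1 := by
    have := circleAverage_fun_smul (c := (0 : ℂ)) (R := 1) (a := k) (f := g)
    simpa only [smul_eq_mul] using this
  rw [circleAverage_eq_circleAverage_comp_mul _ ρ]
  set φ : ℂ → ℝ := fun z ↦ q * (H (ρ * z)).re with hφ
  have hφc : ContinuousOn φ (sphere 0 1) := continuousOn_const.mul (cre (hH.comp hd) _)
  set Z := circleAverage (fun z ↦ Real.exp (p * (H z).re)) 0 1 with hZ
  set Z' := circleAverage (fun z ↦ Real.exp (φ z)) 0 1 with hZ'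
  have hZ0 : 0 < Z := circleAverage_pos (continuousOn_const.mul (cre hH _)).rexp
    fun z _ ↦ Real.exp_pos _
  have hZ0' : 0 < Z' := circleAverage_pos hφc.rexp fun z _ ↦ Real.exp_pos _
  rw [← Real.log_le_log_iff hZ0' (Real.rpow_pos_of_pos hZ0 _), Real.log_rpow hZ0]
  refine le_of_forall_pos_le_add fun ε hε ↦ ?_
  obtain ⟨F, hF, hFφ⟩ := exists_differentiable_re_mem_exp_Icc hφc (half_pos hε)
  set δ := ε / 2 with hδ
  have hpos : ∀ z ∈ sphere (0 : ℂ) 1, 0 < (F z).re :=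
    fun z hz ↦ (Real.exp_pos _).trans_le (hFφ z hz).1
  set a := (F 0).re with ha
  have ha1 : circleAverage (fun z ↦ (F z).re) 0 1 = a := circleAverage_re hF 1
  have ha0 : 0 < a := re_pos_of_forall_sphere hF hpos (mem_closedBall_self zero_le_one)
  have hflog : ContinuousOn (fun z ↦ (F z).re * Real.log (F z).re) (sphere 0 1) :=
    (cre hF _).mul ((cre hF _).log fun z hz ↦ (hpos z hz).ne')
  -- `F.re` is within a factor `exp δ` of the optimiser `exp φ` of the variational problem.
  have hlow : Real.exp (-δ) * Z' ≤ a := by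
    rw [← ha1, hZ', ← S]
    refine circleAverage_mono (((continuousOn_const.mul hφc.rexp)).circleIntegrable zero_le_one)
      ((cre hF _).circleIntegrable zero_le_one) fun z hz ↦ ?_
    rw [abs_one] at hz
    rw [← Real.exp_add, neg_add_eq_sub]
    exact (hFφ z hz).1
  have hent : circleAverage (fun z ↦ (F z).re * Real.log (F z).re) 0 1 ≤
      circleAverage (fun z ↦ (F z).re * φ z) 0 1 + δ * a := by
    have hφF : ContinuousOn (fun z ↦ (F z).re * φ z) (sphere 0 1) := (cre hF _).mul hφc
    have hδF : ContinuousOn (fun z ↦ δ * (F z).re) (sphere 0 1) := continuousOn_const.mul (cre hF _)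
    rw [← ha1, ← S, ← circleAverage_fun_add (hφF.circleIntegrable zero_le_one)
      (hδF.circleIntegrable zero_le_one)]
    refine circleAverage_mono (hflog.circleIntegrable zero_le_one)
      ((hφF.add hδF).circleIntegrable zero_le_one) fun z hz ↦ ?_
    rw [abs_one] at hz
    have : Real.log (F z).re ≤ φ z + δ := by
      rw [← Real.log_exp (φ z + δ)]
      exact Real.log_le_log (hpos z hz) (hFφ z hz).2
    nlinarith [hpos z hz]
  have hsymm : circleAverage (fun z ↦ (F z).re * φ z) 0 1 =
      q * circleAverage (fun z ↦ (F (ρ * z)).re * (H z).re) 0 1 := by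
    rw [← circleAverage_re_mul_re_dilation hF hH hρ0 hρ1, ← S]
    simp only [hφ, mul_left_comm]
  have hposρ : ∀ z ∈ sphere (0 : ℂ) 1, 0 < (F (ρ * z)).re := fun z hz ↦ by
    refine re_pos_of_forall_sphere hF hpos ?_
    rw [mem_closedBall_zero_iff, norm_mul, mem_sphere_zero_iff_norm.1 hz, mul_one,
      Complex.norm_real, Real.norm_of_nonneg hρ0.le]
    exact hρ1
  have hgibbs := gibbs_circleAverage (f := fun z ↦ (F (ρ * z)).re) (φ := fun z ↦ p * (H z).re)
    (cre (hF.comp hd) _) hposρ (continuousOn_const.mul (cre hH _))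
  have haρ : circleAverage (fun z ↦ (F (ρ * z)).re) 0 1 = a := by
    rw [← circleAverage_eq_circleAverage_comp_mul (fun z ↦ (F z).re) ρ, circleAverage_re hF]
  have hcontr := entropy_circleAverage_le hF hpos hρ0 hρ1
  rw [circleAverage_eq_circleAverage_comp_mul _ ρ, hρ2, ← ha] at hcontr
  simp only [haρ, mul_left_comm _ p, S, ← hZ] at hgibbs
  set B := circleAverage (fun z ↦ (F (ρ * z)).re * (H z).re) 0 1
  set E1 := circleAverage (fun z ↦ (F z).re * Real.log (F z).re) 0 1
  set Eρ := circleAverage (fun z ↦ (F (ρ * z)).re * Real.log (F (ρ * z)).re) 0 1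
  rw [hsymm] at hent
  -- Here `ρ⁻² = q / p`, which is the ratio between the two Gibbs inequalities.
  have h1 : q / p * (Eρ - a * Real.log a) ≤ E1 - a * Real.log a := by
    refine (mul_le_mul_of_nonneg_left hcontr (div_pos hq hp).le).trans_eq ?_
    field_simp
  have h2 : q / p * (p * B - (Eρ - a * Real.log a)) ≤ q / p * (a * Real.log Z) :=
    mul_le_mul_of_nonneg_left hgibbs (div_pos hq hp).le
  have h3 : q / p * (p * B - (Eρ - a * Real.log a)) = q * B - q / p * (Eρ - a * Real.log a) := by
    field_simp
  have h4 : a * Real.log a ≤ a * (q / p * Real.log Z + δ) := by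
    rw [h3] at h2
    linarith
  have h5 : Real.log a ≤ q / p * Real.log Z + δ := le_of_mul_le_mul_left h4 ha0
  have h6 : Real.log Z' - δ ≤ Real.log a := by
    have := Real.log_le_log (by positivity) hlow
    rw [Real.log_mul (Real.exp_ne_zero _) hZ0'.ne', Real.log_exp] at this
    linarith
  linarith

/-- Weissler's inequality for entire functions with values in a normed space. By approximation,
`log ‖f‖` may be replaced on the unit circle by a harmonic function `Re H` slightly above it, and the
bound `‖f‖ ≤ exp (Re H)` extends to the disc by the maximum principle for `exp (-H) • f`. -/
theorem circleAverage_norm_rpow_le {Y : Type*} [NormedAddCommGroup Y] [NormedSpace ℂ Y]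
    {f : ℂ → Y} (hf : Differentiable ℂ f) {p q : ℝ} (hp : 0 < p) (hpq : p ≤ q) :
    circleAverage (fun z ↦ ‖f z‖ ^ q) 0 √(p / q) ≤
      circleAverage (fun z ↦ ‖f z‖ ^ p) 0 1 ^ (q / p) := by
  have hq : 0 < q := hp.trans_le hpq
  set ρ := √(p / q) with hρ
  have hρ0 : 0 ≤ ρ := Real.sqrt_nonneg _
  have hρ1 : ρ ≤ 1 := by
    rw [hρ, Real.sqrt_le_one]
    exact (div_le_one hq).2 hpq
  have hbound (t : ℝ) (ht : 0 < t) : circleAverage (fun z ↦ ‖f z‖ ^ q) 0 ρ ≤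
      circleAverage (fun z ↦ (Real.exp (2 * t) * (‖f z‖ + t)) ^ p) 0 1 ^ (q / p) := by
    have hft (z : ℂ) : 0 < ‖f z‖ + t := by positivity
    have hv : Continuous fun z ↦ Real.log (‖f z‖ + t) + t :=
      ((hf.continuous.norm.add continuous_const).log fun z ↦ (hft z).ne').add continuous_const
    obtain ⟨H, hH, hHv⟩ := exists_differentiable_abs_re_sub_lt hv.continuousOn ht
    have cH : Continuous fun z ↦ (H z).re := Complex.continuous_re.comp hH.continuous
    have hmax : ∀ w ∈ closedBall (0 : ℂ) 1, ‖f w‖ ≤ Real.exp (H w).re := by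
      intro w hw
      have := Complex.norm_le_of_forall_mem_frontier_norm_le (U := ball (0 : ℂ) 1)
        (f := fun z ↦ Complex.exp (-H z) • f z) (C := 1) isBounded_ball
        ((hH.neg.cexp.smul hf).diffContOnCl) (fun z hz ↦ by
          rw [frontier_ball (0 : ℂ) one_ne_zero] at hz
          have h := (abs_lt.1 (hHv z hz)).1
          rw [norm_smul, Complex.norm_exp, Complex.neg_re, Real.exp_neg, inv_mul_le_one₀
            (Real.exp_pos _)]
          calc ‖f z‖ ≤ ‖f z‖ + t := by linarith
            _ = Real.exp (Real.log (‖f z‖ + t)) := (Real.exp_log (hft z)).symm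
            _ ≤ Real.exp (H z).re := Real.exp_le_exp.2 (by linarith))
        (by rw [closure_ball (0 : ℂ) one_ne_zero]; exact hw)
      rwa [norm_smul, Complex.norm_exp, Complex.neg_re, Real.exp_neg, inv_mul_le_one₀
        (Real.exp_pos _)] at this
    calc circleAverage (fun z ↦ ‖f z‖ ^ q) 0 ρ
        ≤ circleAverage (fun z ↦ Real.exp (q * (H z).re)) 0 ρ := by
          refine circleAverage_mono ?_ ?_ fun z hz ↦ ?_
          · exact (hf.continuous.norm.rpow_const
              fun _ ↦ .inr hq.le).continuousOn.circleIntegrable'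
          · exact (continuous_const.mul cH).rexp.continuousOn.circleIntegrable'
          · rw [abs_of_nonneg hρ0] at hz
            have h := hmax z (closedBall_subset_closedBall hρ1 (sphere_subset_closedBall hz))
            rw [mul_comm, Real.exp_mul]
            exact Real.rpow_le_rpow (norm_nonneg _) h hq.le
      _ ≤ circleAverage (fun z ↦ Real.exp (p * (H z).re)) 0 1 ^ (q / p) :=
          circleAverage_exp_mul_re_le hH hp hpq
      _ ≤ _ := by
          refine Real.rpow_le_rpow ?_ ?_ (div_pos hq hp).le
          · exact circleAverage_nonneg_of_nonneg fun z _ ↦ (Real.exp_pos _).le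
          refine circleAverage_mono ?_ ?_ fun z hz ↦ ?_
          · exact (continuous_const.mul cH).rexp.continuousOn.circleIntegrable'
          · exact ((continuous_const.mul (hf.continuous.norm.add continuous_const)).rpow_const
              fun _ ↦ .inr hp.le).continuousOn.circleIntegrable'
          · rw [abs_one] at hz
            have h := (abs_lt.1 (hHv z hz)).2
            rw [mul_comm, Real.exp_mul]
            refine Real.rpow_le_rpow (Real.exp_pos _).le ?_ hp.le
            rw [← Real.exp_log (hft z), ← Real.exp_add]
            exact Real.exp_le_exp.2 (by linarith)
  have hcont : Continuous fun t : ℝ ↦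
      circleAverage (fun z ↦ (Real.exp (2 * t) * (‖f z‖ + t)) ^ p) 0 1 ^ (q / p) := by
    refine Continuous.rpow_const ?_ fun _ ↦ .inr (div_pos hq hp).le
    have : Continuous (Function.uncurry fun t θ : ℝ ↦
        (Real.exp (2 * t) * (‖f (circleMap 0 1 θ)‖ + t)) ^ p) := by
      refine Continuous.rpow_const ?_ fun _ ↦ .inr hp.le
      have := hf.continuous
      fun_prop
    exact (intervalIntegral.continuous_parametric_intervalIntegral_of_continuous' this 0
      (2 * π)).const_smul (2 * π)⁻¹
  have hlim := (hcont.tendsto 0).mono_left (nhdsWithin_le_nhds (s := Ioi 0))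
  simp only [mul_zero, Real.exp_zero, one_mul, add_zero] at hlim
  exact ge_of_tendsto hlim (eventually_mem_nhdsWithin.mono hbound)

/-! ### Several variables -/

theorem integral_circleMeasure {E : Type*} [NormedAddCommGroup E] [NormedSpace ℝ E] {g : ℂ → E}
    (hg : Continuous g) : ∫ z : Circle, g z ∂circleMeasure = circleAverage g 0 1 := by
  have hm : Measurable Circle.exp := Circle.exp.continuous.measurable
  have hc : Continuous fun z : Circle ↦ g z := hg.comp continuous_subtype_val
  rw [circleMeasure, integral_map hm.aemeasurable hc.aestronglyMeasurable, integral_smul_measure,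
    ENNReal.toReal_ofReal (by positivity), circleAverage_def,
    ← intervalIntegral.integral_of_le (by linarith [Real.pi_pos])]
  have hper : Function.Periodic (fun θ : ℝ ↦ g (circleMap 0 1 θ)) (2 * π) :=
    (periodic_circleMap 0 1).comp g
  have h := hper.intervalIntegral_add_eq (-π) 0
  rw [zero_add, show -π + 2 * π = π by ring] at h
  rw [← h]
  simp [circleMap]

instance isProbabilityMeasure_circleMeasure : IsProbabilityMeasure circleMeasure := by
  rw [circleMeasure]
  have : IsProbabilityMeasure
      (ENNReal.ofReal (2 * π)⁻¹ • volume.restrict (Ioc (-π) π) : Measure ℝ) := by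
    refine ⟨?_⟩
    rw [Measure.smul_apply, Measure.restrict_apply_univ, Real.volume_Ioc, smul_eq_mul,
      ← ENNReal.ofReal_mul (by positivity), ← ENNReal.ofReal_one]
    congr 1
    field_simp
    ring
  exact Measure.isProbabilityMeasure_map Circle.exp.continuous.measurable.aemeasurable

instance isProbabilityMeasure_torusMeasure (N : ℕ) : IsProbabilityMeasure (torusMeasure N) := by
  rw [torusMeasure]
  infer_instance

theorem integrable_comp_cons {N : ℕ} {g : (Fin (N + 1) → Circle) → ℝ} (hg : Continuous g) :
    Integrable (fun y : Circle × (Fin N → Circle) ↦ g (Fin.cons y.1 y.2))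
      (circleMeasure.prod (torusMeasure N)) := by
  have hc : Continuous fun y : Circle × (Fin N → Circle) ↦ g (Fin.cons y.1 y.2) := by
    refine hg.comp (continuous_pi fun i ↦ ?_)
    refine Fin.cases ?_ (fun i ↦ ?_) i
    · exact continuous_fst
    · exact (continuous_apply i).comp continuous_snd
  exact hc.integrable_of_hasCompactSupport (HasCompactSupport.of_compactSpace _)

theorem integral_torusMeasure_succ {N : ℕ} {g : (Fin (N + 1) → Circle) → ℝ} (hg : Continuous g) :
    ∫ z, g z ∂torusMeasure (N + 1) =
      ∫ w, ∫ z, g (Fin.cons w z) ∂torusMeasure N ∂circleMeasure := by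
  have hmp := (measurePreserving_piFinSuccAbove (fun _ : Fin (N + 1) ↦ circleMeasure) 0).symm
  have h := hmp.integral_comp' g
  rw [torusMeasure, ← h, integral_integral (integrable_comp_cons hg)]
  refine integral_congr_ae (.of_forall fun y ↦ ?_)
  simp [MeasurableEquiv.piFinSuccAbove, Fin.insertNthEquiv]

theorem norm_toLp_rpow {T E : Type*} [TopologicalSpace T] [CompactSpace T] [MeasurableSpace T]
    [BorelSpace T] [SecondCountableTopology T] {μ : Measure T} [IsFiniteMeasure μ]
    [NormedAddCommGroup E] [NormedSpace ℂ E]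
    {q : ℝ} (hq : 0 < q) [Fact (1 ≤ ENNReal.ofReal q)] (g : C(T, E)) :
    ‖ContinuousMap.toLp (ENNReal.ofReal q) μ ℂ g‖ ^ q = ∫ z, ‖g z‖ ^ q ∂μ := by
  have hmem : MemLp g (ENNReal.ofReal q) μ :=
    (memLp_congr_ae (ContinuousMap.coeFn_toLp (𝕜 := ℂ) μ g)).1 (Lp.memLp _)
  rw [Lp.norm_def, eLpNorm_congr_ae (ContinuousMap.coeFn_toLp (𝕜 := ℂ) μ g),
    hmem.eLpNorm_eq_integral_rpow_norm (by simpa using hq) ENNReal.ofReal_ne_top,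
    ENNReal.toReal_ofReal hq.le, ENNReal.toReal_ofReal (by positivity),
    ← Real.rpow_mul (by positivity),
    inv_mul_cancel₀ hq.ne', Real.rpow_one]

/-- Hypercontractivity of dilations on the torus, by induction on the number of variables. The
polynomial is viewed as a function of its first variable with values in `L^q` of the others, so the
vector-valued one-variable inequality applies and no separate use of Minkowski's inequality is
needed. The index type `ι` of the monomials is arbitrary so that fixing a variable keeps the shape.
-/
theorem integral_torus_norm_rpow_dilation_le {X : Type*} [NormedAddCommGroup X] [NormedSpace ℂ X]
    {ι : Type*} (A : Finset ι) {p q : ℝ} (hp : 1 ≤ p) (hpq : p ≤ q) {N : ℕ}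
    (β : ι → Fin N → ℕ) (x : ι → X) :
    ∫ z, ‖∑ j ∈ A, (∏ i, ((√(p / q) : ℝ) * (z i : ℂ)) ^ β j i) • x j‖ ^ q ∂torusMeasure N ≤
      (∫ z, ‖∑ j ∈ A, (∏ i, (z i : ℂ) ^ β j i) • x j‖ ^ p ∂torusMeasure N) ^ (q / p) := by
  have hp0 : 0 < p := zero_lt_one.trans_le hp
  have hq0 : 0 < q := hp0.trans_le hpq
  have hpq0 : 0 < q / p := div_pos hq0 hp0
  have : Fact (1 ≤ ENNReal.ofReal q) :=
    ⟨by rw [← ENNReal.ofReal_one]; exact ENNReal.ofReal_le_ofReal (hp.trans hpq)⟩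
  set ρ := √(p / q) with hρ
  induction N generalizing x with
  | zero =>
    simp only [Finset.univ_eq_empty, Finset.prod_empty, one_smul, integral_const, smul_eq_mul,
      probReal_univ, one_mul]
    rw [← Real.rpow_mul (norm_nonneg _), mul_div_cancel₀ _ hp0.ne']
  | succ N ih =>
    -- The polynomial in the first variable, with values in `L^q` of the remaining ones.
    let b (j : ι) : C(Fin N → Circle, X) :=
      ⟨fun z ↦ (∏ i, ((ρ : ℂ) * (z i : ℂ)) ^ β j i.succ) • x j, by fun_prop⟩
    let u (w : ℂ) : Lp X (ENNReal.ofReal q) (torusMeasure N) :=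
      ContinuousMap.toLp (ENNReal.ofReal q) (torusMeasure N) ℂ (∑ j ∈ A, w ^ β j 0 • b j)
    have hu : Differentiable ℂ u := by
      refine (ContinuousLinearMap.differentiable _).comp ?_
      fun_prop
    have hun (w : ℂ) : ‖u w‖ ^ q = ∫ z, ‖∑ j ∈ A,
        (∏ i, ((ρ : ℂ) * (z i : ℂ)) ^ β j (Fin.succ i)) • w ^ β j 0 • x j‖ ^ q
          ∂torusMeasure N := by
      rw [norm_toLp_rpow hq0]
      congr 1
      ext z
      rw [ContinuousMap.sum_apply]
      congr 2
      refine Finset.sum_congr rfl fun j _ ↦ ?_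
      rw [ContinuousMap.smul_apply, smul_comm]
      rfl
    have hcu : Continuous fun w ↦ ‖u w‖ := hu.continuous.norm
    -- The induction hypothesis for the other variables, with the first variable fixed.
    have hle (w : ℂ) : ‖u w‖ ^ p ≤ ∫ z, ‖∑ j ∈ A,
        (∏ i, (z i : ℂ) ^ β j (Fin.succ i)) • w ^ β j 0 • x j‖ ^ p ∂torusMeasure N := by
      have h := ih (fun j i ↦ β j i.succ) fun j ↦ w ^ β j 0 • x j
      rw [← hun] at h
      have h2 := Real.rpow_le_rpow (by positivity) h (div_pos hp0 hq0).le
      rwa [← Real.rpow_mul (norm_nonneg _), mul_div_cancel₀ _ hq0.ne',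
        ← Real.rpow_mul (integral_nonneg fun z ↦ by positivity), div_mul_div_cancel₀ hp0.ne',
        div_self hq0.ne', Real.rpow_one] at h2
    have hmain := circleAverage_norm_rpow_le hu hp0 hpq
    have hcρ : Continuous fun w : ℂ ↦ ‖u (ρ * w)‖ ^ q :=
      (hcu.comp (continuous_const_mul (ρ : ℂ))).rpow_const fun _ ↦ .inr hq0.le
    rw [← hρ, circleAverage_eq_circleAverage_comp_mul _ ρ, ← integral_circleMeasure hcρ,
      ← integral_circleMeasure (hcu.rpow_const fun _ ↦ .inr hp0.le)] at hmain
    have hcp : Continuous fun z : Fin (N + 1) → Circle ↦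
        ‖∑ j ∈ A, (∏ i, (z i : ℂ) ^ β j i) • x j‖ ^ p :=
      Continuous.rpow_const (by fun_prop) fun _ ↦ .inr hp0.le
    have hcq : Continuous fun z : Fin (N + 1) → Circle ↦
        ‖∑ j ∈ A, (∏ i, ((ρ : ℂ) * (z i : ℂ)) ^ β j i) • x j‖ ^ q :=
      Continuous.rpow_const (by fun_prop) fun _ ↦ .inr hq0.le
    rw [integral_torusMeasure_succ hcq, integral_torusMeasure_succ hcp]
    calc _ = ∫ w : Circle, ‖u (ρ * w)‖ ^ q ∂circleMeasure := by
          simp only [hun, Fin.prod_univ_succ, Fin.cons_zero, Fin.cons_succ, smul_smul, mul_comm]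
      _ ≤ _ := hmain
      _ ≤ _ := by
          refine Real.rpow_le_rpow (integral_nonneg fun z ↦ by positivity) ?_ hpq0.le
          refine integral_mono ?_ (integrable_comp_cons hcp).integral_prod_left
            fun w ↦ (hle w).trans_eq ?_
          · have hc : Continuous fun w : Circle ↦ ‖u w‖ ^ p :=
              (hcu.comp continuous_subtype_val).rpow_const fun _ ↦ .inr hp0.le
            exact hc.integrable_of_hasCompactSupport (HasCompactSupport.of_compactSpace _)
          · simp only [Fin.prod_univ_succ, Fin.cons_zero, Fin.cons_succ, smul_smul, mul_comm]

theorem prod_mul_pow_of_mem_piAntidiag {N m : ℕ} {α : Fin N → ℕ}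
    (hα : α ∈ (Finset.univ : Finset (Fin N)).piAntidiag m) (c : ℂ) (z : Fin N → ℂ) :
    ∏ i, (c * z i) ^ α i = c ^ m * ∏ i, z i ^ α i := by
  rw [Finset.mem_piAntidiag] at hα
  simp only [mul_pow, Finset.prod_mul_distrib, Finset.prod_pow_eq_pow_sum]
  rw [hα.1]

theorem proposition1p2 {X : Type*} [NormedAddCommGroup X] [NormedSpace ℂ X] [CompleteSpace X]
    (r s : ℝ) (hs : 1 ≤ s) (hsr : s ≤ r) (N m : ℕ) (x : (Fin N → ℕ) → X) :
    (∫ z, ‖homogPoly m x z‖ ^ r ∂torusMeasure N) ^ (1 / r) ≤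
      (r / s) ^ ((m : ℝ) / 2) * (∫ z, ‖homogPoly m x z‖ ^ s ∂torusMeasure N) ^ (1 / s) := by
  have hs0 : 0 < s := zero_lt_one.trans_le hs
  have hr0 : 0 < r := hs0.trans_le hsr
  have h := integral_torus_norm_rpow_dilation_le
    ((Finset.univ : Finset (Fin N)).piAntidiag m) hs hsr (fun α i ↦ α i) x
  have hhom (z : Fin N → Circle) :
      ∑ α ∈ (Finset.univ : Finset (Fin N)).piAntidiag m,
        (∏ i, ((√(s / r) : ℝ) * (z i : ℂ)) ^ α i) • x α =
      ((√(s / r) : ℝ) : ℂ) ^ m • homogPoly m x z := by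
    rw [homogPoly, Finset.smul_sum]
    refine Finset.sum_congr rfl fun α hα ↦ ?_
    rw [prod_mul_pow_of_mem_piAntidiag hα _ fun i ↦ (z i : ℂ), mul_smul]
  have hρ : 0 < √(s / r) := Real.sqrt_pos.2 (div_pos hs0 hr0)
  have hnorm (z : Fin N → Circle) : ‖((√(s / r) : ℝ) : ℂ) ^ m • homogPoly m x z‖ ^ r =
      (√(s / r) ^ m) ^ r * ‖homogPoly m x z‖ ^ r := by
    rw [norm_smul, norm_pow, Complex.norm_real, Real.norm_of_nonneg hρ.le,
      Real.mul_rpow (by positivity) (norm_nonneg _)]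
  simp only [hhom, hnorm, integral_const_mul] at h
  change _ ≤ (∫ z, ‖homogPoly m x z‖ ^ s ∂torusMeasure N) ^ (r / s) at h
  have hI : 0 ≤ ∫ z, ‖homogPoly m x z‖ ^ r ∂torusMeasure N := integral_nonneg fun z ↦ by positivity
  have hJ : 0 ≤ ∫ z, ‖homogPoly m x z‖ ^ s ∂torusMeasure N := integral_nonneg fun z ↦ by positivity
  have h2 := Real.rpow_le_rpow (by positivity) h (one_div_pos.2 hr0).le
  rw [Real.mul_rpow (by positivity) hI, ← Real.rpow_mul (by positivity), mul_one_div_cancel hr0.ne',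
    Real.rpow_one, ← Real.rpow_mul hJ, show r / s * (1 / r) = 1 / s by field_simp] at h2
  have h3 : (r / s) ^ ((m : ℝ) / 2) = (√(s / r) ^ m)⁻¹ := by
    rw [← Real.rpow_natCast, Real.sqrt_eq_rpow, ← Real.rpow_mul (div_pos hs0 hr0).le,
      ← Real.inv_rpow (div_pos hs0 hr0).le, inv_div]
    congr 1
    ring
  rw [h3, inv_mul_eq_div, le_div_iff₀' (by positivity)]
  exact h2
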